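/- Let $N\in\mathbb{N}$ and let $\Omega\subset\mathbb{R}^N$ be the (compact) closure of a bounded connected open set with smooth boundary. Let $1<p<\infty$ and $q=p/(p-1)$. Let $\mathcal{H}:\Omega\times\mathbb{R}^N\to\mathbb{R}$ be a Carathéodory function (Lebesgue measurable in $x$, continuous in $z$), convex in $z$ for every $x\in\Omega$, and such that for some $0<\lambda\le 1$ $$\lambda(|z|^p-1)\le \mathcal{H}(x,z)\le \tfrac1\lambda(|z|^p+1)\qquad\text{for all }(x,z)\in\Omega\times\mathbb{R}^N.$$ Let $\dot W^{1,q}(\Omega)$ be the quotient of $W^{1,q}(\Omega)$ by the functions that are a.e. constant, with the norm $\|u\|=\left(\int_\Omega|\nabla u|^q\,dx\right)^{1/q}$, and let $\dot W^{-1,p}(\Omega)$ be its dual space, with the dual norm. For $T\in\dot W^{-1,p}(\Omega)$ and $V\in L^p(\Omega;\mathbb{R}^N)$ write $-\operatorname{div}V=T$ in $\Omega$, $V\cdot\nu_\Omega=0$ on $\partial\Omega$, if $\int_\Omega\nabla\varphi\cdot V\,dx=\langle T,\varphi\rangle$ for every $\varphi\in C^1(\Omega)$. Then for every $T\in\dot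 W^{-1,p}(\Omega)$ the minimum $$\mathfrak{F}_{\mathcal{H}}(T)=\min_{V\in L^p(\Omega;\mathbb{R}^N)}\left\{\int_\Omega\mathcal{H}(x,V(x))\,dx\ :\ -\operatorname{div}V=T\text{ in }\Omega,\ V\cdot\nu_\Omega=0\text{ on }\partial\Omega\right\}$$ exists, and the functional $\mathfrak{F}_{\mathcal{H}}:\dot W^{-1,p}(\Omega)\to\mathbb{R}$ is convex, lower semicontinuous for the weak topology of $\dot W^{-1,p}(\Omega)$, and the pointwise supremum of a family of continuous affine functionals on $\dot W^{-1,p}(\Omega)$. -/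

import Mathlib

open MeasureTheory Set Topology
open scoped ContDiff ENNReal

noncomputable section

namespace Beckmann

/-- A bounded connected open subset of `ℝᴺ` with smooth boundary: near each boundary point the set
is the strict sublevel set of a smooth function whose differential does not vanish there. -/
structure SmoothDomain (N : ℕ) where
  carrier : Set (EuclideanSpace ℝ (Fin N))
  isOpen : IsOpen carrier
  isBounded : Bornology.IsBounded carrier
  isConnected : IsConnected carrier
  smooth_boundary : ∀ x ∈ frontier carrier,
    ∃ (W : Set (EuclideanSpace ℝ (Fin N))) (ρ : EuclideanSpace ℝ (Fin N) → ℝ),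
      IsOpen W ∧ x ∈ W ∧ ContDiffOn ℝ ∞ ρ W ∧ fderiv ℝ ρ x ≠ 0 ∧
        carrier ∩ W = {y ∈ W | ρ y < 0}

variable {N : ℕ}

/-- The compact set `Ω`, the closure of the open set `carrier`. -/
def SmoothDomain.closedSet (Ω : SmoothDomain N) : Set (EuclideanSpace ℝ (Fin N)) :=
  closure Ω.carrier

/-- Lebesgue measure on the domain. The boundary is smooth, hence Lebesgue null, so that
integrating over the open set and over its closure is the same. -/
def SmoothDomain.vol (Ω : SmoothDomain N) : Measure (EuclideanSpace ℝ (Fin N)) :=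
  volume.restrict Ω.carrier

instance (Ω : SmoothDomain N) : IsFiniteMeasure Ω.vol :=
  ⟨by simpa [SmoothDomain.vol] using Ω.isBounded.measure_lt_top⟩

instance (q : ℝ) [hq : Fact (1 < q)] : Fact (1 ≤ ENNReal.ofReal q) :=
  ⟨by simpa using ENNReal.ofReal_le_ofReal hq.out.le⟩

/-- The real space `L^q(Ω)`. -/
abbrev LpScalar (Ω : SmoothDomain N) (q : ℝ) : Type := Lp ℝ (ENNReal.ofReal q) Ω.vol

/-- The space `L^q(Ω; ℝᴺ)` of vector fields (with the Euclidean norm on `ℝᴺ`). -/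
abbrev LpVector (Ω : SmoothDomain N) (q : ℝ) : Type :=
  Lp (EuclideanSpace ℝ (Fin N)) (ENNReal.ofReal q) Ω.vol

/-- `G` is the distributional gradient of `u` in the open set:
`∫ u ∂ᵥψ = - ∫ ψ G·v` for all directions `v` and all `ψ ∈ C_c^∞`. -/
def IsWeakGradient (Ω : SmoothDomain N) (u : EuclideanSpace ℝ (Fin N) → ℝ)
    (G : EuclideanSpace ℝ (Fin N) → EuclideanSpace ℝ (Fin N)) : Prop :=
  ∀ (ψ : EuclideanSpace ℝ (Fin N) → ℝ) (v : EuclideanSpace ℝ (Fin N)),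
    ContDiff ℝ ∞ ψ → HasCompactSupport ψ → tsupport ψ ⊆ Ω.carrier →
      ∫ x, u x * fderiv ℝ ψ x v ∂Ω.vol = - ∫ x, ψ x * inner ℝ (G x) v ∂Ω.vol

lemma exists_bound_of_test {f : EuclideanSpace ℝ (Fin N) → ℝ} (hf : Continuous f)
    (hs : HasCompactSupport f) : ∃ C, ∀ x, ‖f x‖ ≤ C :=
  hs.exists_bound_of_continuous hf

lemma continuous_fderiv_apply_const {k : WithTop ℕ∞} (hk : k ≠ 0)
    {ψ : EuclideanSpace ℝ (Fin N) → ℝ}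
    (h : ContDiff ℝ k ψ) (v : EuclideanSpace ℝ (Fin N)) :
    Continuous (fun x => fderiv ℝ ψ x v) :=
  (h.continuous_fderiv hk).clm_apply continuous_const

lemma integrable_mul_fderiv {Ω : SmoothDomain N} {u : EuclideanSpace ℝ (Fin N) → ℝ}
    (hu : Integrable u Ω.vol) {ψ : EuclideanSpace ℝ (Fin N) → ℝ}
    (h : ContDiff ℝ ∞ ψ) (hs : HasCompactSupport ψ) (v : EuclideanSpace ℝ (Fin N)) :
    Integrable (fun x => u x * fderiv ℝ ψ x v) Ω.vol := by
  have hc := continuous_fderiv_apply_const (by simp) h v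
  obtain ⟨C, hC⟩ := exists_bound_of_test hc (hs.fderiv_apply ℝ v)
  exact hu.mul_bdd hc.aestronglyMeasurable (Filter.Eventually.of_forall hC)

lemma integrable_mul_inner {Ω : SmoothDomain N}
    {G : EuclideanSpace ℝ (Fin N) → EuclideanSpace ℝ (Fin N)}
    (hG : Integrable G Ω.vol) {ψ : EuclideanSpace ℝ (Fin N) → ℝ}
    (h : Continuous ψ) (hs : HasCompactSupport ψ) (v : EuclideanSpace ℝ (Fin N)) :
    Integrable (fun x => ψ x * inner ℝ (G x) v) Ω.vol := by
  obtain ⟨C, hC⟩ := exists_bound_of_test h hs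
  exact (hG.inner_const v).bdd_mul h.aestronglyMeasurable (Filter.Eventually.of_forall hC)

section Sobolev

variable (Ω : SmoothDomain N) (q : ℝ) [hq : Fact (1 < q)]

/-- The Sobolev space `W^{1,q}(Ω)`. An element is recorded as a pair `(u, ∇u)`, where `u` lies in
`L^q(Ω)` and its distributional gradient `∇u` lies in `L^q(Ω; ℝᴺ)`. -/
def sobolev : Submodule ℝ (LpScalar Ω q × LpVector Ω q) where
  carrier := {w | IsWeakGradient Ω w.1 w.2}
  add_mem' := by
    rintro ⟨u, G⟩ ⟨u', G'⟩ h h' ψ v h1 h2 h3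
    have hu := (Lp.memLp u).integrable (Fact.out : 1 ≤ ENNReal.ofReal q)
    have hu' := (Lp.memLp u').integrable (Fact.out : 1 ≤ ENNReal.ofReal q)
    have hG := (Lp.memLp G).integrable (Fact.out : 1 ≤ ENNReal.ofReal q)
    have hG' := (Lp.memLp G').integrable (Fact.out : 1 ≤ ENNReal.ofReal q)
    have e1 : ∫ x, (u + u' : LpScalar Ω q) x * fderiv ℝ ψ x v ∂Ω.vol
        = ∫ x, (u x * fderiv ℝ ψ x v + u' x * fderiv ℝ ψ x v) ∂Ω.vol := by
      refine integral_congr_ae ?_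
      filter_upwards [Lp.coeFn_add u u'] with x hx
      rw [hx, Pi.add_apply, add_mul]
    have e2 : ∫ x, ψ x * inner ℝ ((G + G' : LpVector Ω q) x) v ∂Ω.vol
        = ∫ x, (ψ x * inner ℝ (G x) v + ψ x * inner ℝ (G' x) v) ∂Ω.vol := by
      refine integral_congr_ae ?_
      filter_upwards [Lp.coeFn_add G G'] with x hx
      rw [hx, Pi.add_apply, inner_add_left, mul_add]
    have a := h ψ v h1 h2 h3
    have b := h' ψ v h1 h2 h3
    simp only [Prod.mk_add_mk] at a b ⊢
    rw [e1, e2, integral_add (integrable_mul_fderiv hu h1 h2 v) (integrable_mul_fderiv hu' h1 h2 v),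
      integral_add (integrable_mul_inner hG h1.continuous h2 v)
        (integrable_mul_inner hG' h1.continuous h2 v), a, b]
    ring
  zero_mem' := by
    intro ψ v _ _ _
    have e1 : ∫ x, (0 : LpScalar Ω q) x * fderiv ℝ ψ x v ∂Ω.vol = ∫ _x, (0 : ℝ) ∂Ω.vol := by
      refine integral_congr_ae ?_
      filter_upwards [Lp.coeFn_zero ℝ (ENNReal.ofReal q) Ω.vol] with x hx
      rw [hx]
      simp
    have e2 : ∫ x, ψ x * inner ℝ ((0 : LpVector Ω q) x) v ∂Ω.vol = ∫ _x, (0 : ℝ) ∂Ω.vol := by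
      refine integral_congr_ae ?_
      filter_upwards [Lp.coeFn_zero (EuclideanSpace ℝ (Fin N)) (ENNReal.ofReal q) Ω.vol] with x hx
      rw [hx]
      simp
    simp only [Prod.fst_zero, Prod.snd_zero]
    rw [e1, e2]
    simp
  smul_mem' := by
    rintro c ⟨u, G⟩ h ψ v h1 h2 h3
    have e1 : ∫ x, (c • u : LpScalar Ω q) x * fderiv ℝ ψ x v ∂Ω.vol
        = ∫ x, c * (u x * fderiv ℝ ψ x v) ∂Ω.vol := by
      refine integral_congr_ae ?_
      filter_upwards [Lp.coeFn_smul c u] with x hx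
      rw [hx, Pi.smul_apply, smul_eq_mul, mul_assoc]
    have e2 : ∫ x, ψ x * inner ℝ ((c • G : LpVector Ω q) x) v ∂Ω.vol
        = ∫ x, c * (ψ x * inner ℝ (G x) v) ∂Ω.vol := by
      refine integral_congr_ae ?_
      filter_upwards [Lp.coeFn_smul c G] with x hx
      rw [hx, Pi.smul_apply, real_inner_smul_left]
      ring
    have a := h ψ v h1 h2 h3
    simp only [Prod.smul_mk] at a ⊢
    rw [e1, e2, integral_const_mul, integral_const_mul, a]
    ring

/-- The elements of `W^{1,q}(Ω)` that are almost everywhere equal to a constant. -/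
def constants : Submodule ℝ (sobolev Ω q) where
  carrier := {w | ∃ c : ℝ, w.1.1 =ᵐ[Ω.vol] fun _ => c}
  add_mem' := by
    rintro w w' ⟨c, h⟩ ⟨c', h'⟩
    refine ⟨c + c', ?_⟩
    filter_upwards [Lp.coeFn_add w.1.1 w'.1.1, h, h'] with x hx h1 h2
    simpa [h1, h2] using hx
  zero_mem' := ⟨0, Lp.coeFn_zero ℝ (ENNReal.ofReal q) Ω.vol⟩
  smul_mem' := by
    rintro a w ⟨c, h⟩
    refine ⟨a * c, ?_⟩
    filter_upwards [Lp.coeFn_smul a w.1.1, h] with x hx h1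
    simpa [h1] using hx

/-- The gradient, as a linear map `W^{1,q}(Ω) → L^q(Ω; ℝᴺ)`. -/
def sobolevGrad : sobolev Ω q →ₗ[ℝ] LpVector Ω q :=
  (LinearMap.snd ℝ (LpScalar Ω q) (LpVector Ω q)).comp (sobolev Ω q).subtype

lemma constants_le_ker : constants Ω q ≤ LinearMap.ker (sobolevGrad Ω q) := by
  rintro ⟨⟨u, G⟩, hw⟩ ⟨c, hc⟩
  have hw' : IsWeakGradient Ω u G := hw
  have hG := (Lp.memLp G).integrable (Fact.out : 1 ≤ ENNReal.ofReal q)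
  have key : ∀ v : EuclideanSpace ℝ (Fin N), ∀ᵐ x ∂Ω.vol, inner ℝ (G x) v = 0 := by
    intro v
    have hloc : LocallyIntegrableOn (fun x => inner ℝ (G x) v) Ω.carrier volume := by
      refine IntegrableOn.locallyIntegrableOn ?_
      exact hG.inner_const v
    have := Ω.isOpen.ae_eq_zero_of_integral_contDiff_smul_eq_zero (μ := volume) hloc ?_
    · exact (ae_restrict_iff' Ω.isOpen.measurableSet).2 this
    · intro ψ h1 h2 h3
      have a := hw' ψ v h1 h2 h3
      have e1 : ∫ x, u x * fderiv ℝ ψ x v ∂Ω.vol = ∫ x, c * fderiv ℝ ψ x v ∂Ω.vol := by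
        refine integral_congr_ae ?_
        filter_upwards [hc] with x hx
        rw [hx]
      have e2 : ∫ x, fderiv ℝ ψ x v ∂Ω.vol = ∫ x, fderiv ℝ ψ x v := by
        refine setIntegral_eq_integral_of_forall_compl_eq_zero fun x hx => ?_
        have : x ∉ tsupport (fderiv ℝ ψ) := fun h => hx (h3 (tsupport_fderiv_subset ℝ h))
        simp [image_eq_zero_of_notMem_tsupport this]
      have e3 : ∫ x, fderiv ℝ ψ x v = 0 := by
        have hd := continuous_fderiv_apply_const (by simp) h1 v
        have := integral_mul_fderiv_eq_neg_fderiv_mul_of_integrable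
          (μ := (volume : Measure (EuclideanSpace ℝ (Fin N)))) (𝕜 := ℝ)
          (f := fun _ => (1 : ℝ)) (g := ψ) (v := v) (by simp)
          (by simpa using hd.integrable_of_hasCompactSupport (h2.fderiv_apply ℝ v))
          (by simpa using h1.continuous.integrable_of_hasCompactSupport h2)
          (fun x _ => by fun_prop) (fun x _ => h1.contDiffAt.differentiableAt (by simp))
        simpa using this
      have e4 : ∫ x, ψ x * inner ℝ (G x) v ∂Ω.vol = ∫ x, ψ x * inner ℝ (G x) v := by
        refine setIntegral_eq_integral_of_forall_compl_eq_zero fun x hx => ?_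
        have : x ∉ tsupport ψ := fun h => hx (h3 h)
        simp [image_eq_zero_of_notMem_tsupport this]
      rw [e1, integral_const_mul, e2, e3, e4] at a
      simpa using a.symm
  have hz : G = 0 := by
    refine Lp.ext ?_
    have hall : ∀ᵐ x ∂Ω.vol, ∀ i : Fin N, inner ℝ (G x) (EuclideanSpace.single i (1 : ℝ)) = 0 :=
      ae_all_iff.2 fun i => key _
    filter_upwards [hall, Lp.coeFn_zero (EuclideanSpace ℝ (Fin N)) (ENNReal.ofReal q) Ω.vol]
      with x hx h0
    rw [h0]
    ext i
    have hi := hx i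
    rw [EuclideanSpace.inner_single_right] at hi
    simpa using hi
  simpa [sobolevGrad] using hz

/-- The homogeneous space `W^{1,q}(Ω) / ~`, where `u ~ v` if `u - v` is a.e. constant. -/
def HomSobolev : Type := sobolev Ω q ⧸ constants Ω q

instance : AddCommGroup (HomSobolev Ω q) :=
  inferInstanceAs (AddCommGroup (sobolev Ω q ⧸ constants Ω q))

instance : Module ℝ (HomSobolev Ω q) :=
  inferInstanceAs (Module ℝ (sobolev Ω q ⧸ constants Ω q))

/-- The class of a Sobolev function modulo constants. -/
def HomSobolev.mk : sobolev Ω q →ₗ[ℝ] HomSobolev Ω q := (constants Ω q).mkQ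

/-- The gradient of a class modulo constants. -/
def HomSobolev.grad : HomSobolev Ω q →ₗ[ℝ] LpVector Ω q :=
  (constants Ω q).liftQ (sobolevGrad Ω q) (constants_le_ker Ω q)

/-- The norm `‖u‖ = (∫ |∇u|^q)^{1/q}` on the homogeneous Sobolev space (it is definite, since the
domain is connected; only the seminorm axioms are needed to form the dual space). -/
instance : SeminormedAddCommGroup (HomSobolev Ω q) :=
  SeminormedAddCommGroup.induced (HomSobolev Ω q) (LpVector Ω q) (HomSobolev.grad Ω q)

instance : NormedSpace ℝ (HomSobolev Ω q) :=
  NormedSpace.induced ℝ (HomSobolev Ω q) (LpVector Ω q) (HomSobolev.grad Ω q)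

lemma HomSobolev.norm_mk (w : sobolev Ω q) : ‖HomSobolev.mk Ω q w‖ = ‖w.1.2‖ := rfl

/-- The dual `W^{-1,p}(Ω)` of the homogeneous space (`p` conjugate to `q`), with the dual norm. -/
abbrev DualSobolev : Type := StrongDual ℝ (HomSobolev Ω q)

/-- A `C¹` function, viewed in `W^{1,q}(Ω)`. As the boundary is smooth, `C¹(Ω)` (derivatives
continuous up to the boundary) consists of the restrictions of `C¹` functions on `ℝᴺ`. -/
def ofC1 (φ : EuclideanSpace ℝ (Fin N) → ℝ) (hφ : ContDiff ℝ 1 φ) : sobolev Ω q := by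
  have hb {F : Type} [NormedAddCommGroup F] (f : EuclideanSpace ℝ (Fin N) → F)
      (hf : Continuous f) (hm : AEStronglyMeasurable f Ω.vol) :
      MemLp f (ENNReal.ofReal q) Ω.vol := by
    obtain ⟨C, hC⟩ := Ω.isBounded.isCompact_closure.exists_bound_of_continuousOn hf.continuousOn
    refine MemLp.of_bound hm C ?_
    exact (ae_restrict_iff' Ω.isOpen.measurableSet).2
      (Filter.Eventually.of_forall fun x hx => hC x (subset_closure hx))
  have hg : Continuous (gradient φ) :=
    (LinearIsometryEquiv.continuous _).comp (hφ.continuous_fderiv (by simp))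
  refine ⟨((hb φ hφ.continuous hφ.continuous.aestronglyMeasurable).toLp φ,
    (hb (gradient φ) hg hg.aestronglyMeasurable).toLp (gradient φ)), ?_⟩
  intro ψ v h1 h2 h3
  have hz : ∀ x ∉ Ω.carrier, ψ x = 0 := fun x hx =>
    image_eq_zero_of_notMem_tsupport fun h => hx (h3 h)
  have hz' : ∀ x ∉ Ω.carrier, fderiv ℝ ψ x = 0 := fun x hx =>
    image_eq_zero_of_notMem_tsupport fun h => hx (h3 (tsupport_fderiv_subset ℝ h))
  have e1 : ∫ x, ((hb φ hφ.continuous hφ.continuous.aestronglyMeasurable).toLp φ) x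
      * fderiv ℝ ψ x v ∂Ω.vol = ∫ x, φ x * fderiv ℝ ψ x v := by
    rw [← setIntegral_eq_integral_of_forall_compl_eq_zero (s := Ω.carrier)
      (f := fun x => φ x * fderiv ℝ ψ x v) fun x hx => by simp [hz' x hx]]
    refine integral_congr_ae ?_
    filter_upwards [MemLp.coeFn_toLp (hb φ hφ.continuous hφ.continuous.aestronglyMeasurable)]
      with x hx
    rw [hx]
  have e2 : ∫ x, ψ x * inner ℝ (((hb (gradient φ) hg hg.aestronglyMeasurable).toLp
      (gradient φ)) x) v ∂Ω.vol = ∫ x, fderiv ℝ φ x v * ψ x := by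
    rw [← setIntegral_eq_integral_of_forall_compl_eq_zero (s := Ω.carrier)
      (f := fun x => fderiv ℝ φ x v * ψ x) fun x hx => by simp [hz x hx]]
    refine integral_congr_ae ?_
    filter_upwards [MemLp.coeFn_toLp (hb (gradient φ) hg hg.aestronglyMeasurable)] with x hx
    rw [hx, mul_comm]
    congr 1
    simp [gradient]
  have hdφ := continuous_fderiv_apply_const (by simp) hφ v
  have hdψ := continuous_fderiv_apply_const (by simp) h1 v
  refine e1.trans (Eq.trans ?_ (congrArg Neg.neg e2.symm))
  exact integral_mul_fderiv_eq_neg_fderiv_mul_of_integrable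
    ((hdφ.mul h1.continuous).integrable_of_hasCompactSupport h2.mul_left)
    ((hφ.continuous.mul hdψ).integrable_of_hasCompactSupport (h2.fderiv_apply ℝ v).mul_left)
    ((hφ.continuous.mul h1.continuous).integrable_of_hasCompactSupport h2.mul_left)
    (fun x _ => hφ.contDiffAt.differentiableAt (by simp))
    (fun x _ => h1.contDiffAt.differentiableAt (by simp))

end Sobolev

/-- The weak formulation of `-div V = T` in `Ω`, `V·ν = 0` on `∂Ω`:
`∫ ∇φ·V = ⟨T, φ⟩` for every `φ ∈ C¹(Ω)`. -/
def IsAdmissible (Ω : SmoothDomain N) (p q : ℝ) [Fact (1 < q)] (T : DualSobolev Ω q)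
    (V : LpVector Ω p) : Prop :=
  ∀ (φ : EuclideanSpace ℝ (Fin N) → ℝ) (hφ : ContDiff ℝ 1 φ),
    ∫ x, inner ℝ (gradient φ x) (V x) ∂Ω.vol = T (HomSobolev.mk Ω q (ofC1 Ω q φ hφ))

/-- The standing assumptions on the integrand `𝓗 : Ω × ℝᴺ → ℝ` (whose values for `x` outside `Ω`
are irrelevant): it is a Carathéodory function, convex in the second variable, of `p`-growth. -/
structure IsAdmissibleIntegrand (Ω : SmoothDomain N) (p : ℝ)
    (H : EuclideanSpace ℝ (Fin N) → EuclideanSpace ℝ (Fin N) → ℝ) : Prop where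
  /-- Lebesgue measurability of `x ↦ 𝓗(x, z)` on `Ω`. -/
  measurable : ∀ z, AEMeasurable (fun x => H x z) (volume.restrict Ω.closedSet)
  continuous : ∀ x ∈ Ω.closedSet, Continuous (H x)
  convex : ∀ x ∈ Ω.closedSet, ConvexOn ℝ univ (H x)
  growth : ∃ l : ℝ, 0 < l ∧ l ≤ 1 ∧ ∀ x ∈ Ω.closedSet, ∀ z,
    l * (‖z‖ ^ p - 1) ≤ H x z ∧ H x z ≤ (1 / l) * (‖z‖ ^ p + 1)

/-- The energy `∫_Ω 𝓗(x, V(x)) dx`. -/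
def energy (Ω : SmoothDomain N) (p : ℝ)
    (H : EuclideanSpace ℝ (Fin N) → EuclideanSpace ℝ (Fin N) → ℝ) (V : LpVector Ω p) : ℝ :=
  ∫ x, H x (V x) ∂Ω.vol

/-- The set of the energies of all competitors in Beckmann's problem with datum `T`. -/
def competitorEnergies (Ω : SmoothDomain N) (p q : ℝ) [Fact (1 < q)]
    (H : EuclideanSpace ℝ (Fin N) → EuclideanSpace ℝ (Fin N) → ℝ) (T : DualSobolev Ω q) : Set ℝ :=
  energy Ω p H '' {V | IsAdmissible Ω p q T V}

/-- The value functional `𝔉_𝓗 : T ↦` minimal value of Beckmann's problem with datum `T`. -/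
def beckmannValue (Ω : SmoothDomain N) (p q : ℝ) [Fact (1 < q)]
    (H : EuclideanSpace ℝ (Fin N) → EuclideanSpace ℝ (Fin N) → ℝ) (T : DualSobolev Ω q) : ℝ :=
  sInf (competitorEnergies Ω p q H T)

end Beckmann

end

/-! The gradient embeds the homogeneous Sobolev space isometrically into `L^q`, so Hahn–Banach
extends a datum `T` to all of `L^q` without increasing its norm, and Riesz representation turns the
extension into a field `V` in `L^p` with `‖V‖ ≤ ‖T‖` that is admissible for `T`
(`exists_isAdmissible`). The competitors thus form a nonempty closed convex set. On it the energy is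
convex, continuous and coercive, and `L^p` is reflexive, so the direct method gives a minimizer
(`ConvexOn.exists_isMinOn_of_pairing`).

The constraint is jointly linear in `(T, V)`, so the value functional is convex, as a partial
minimum of a convex function. The bound `‖V‖ ≤ ‖T‖` and the upper growth of the integrand bound it
above on the unit ball, and a convex function bounded above on a ball is norm continuous.
Hahn–Banach then writes it as the supremum of its continuous affine minorants. These are weakly
continuous, so weak lower semicontinuity follows without any compactness argument in `T`. -/

noncomputable section

namespace MeasureTheory

/-! ### Riesz duality between vector-valued `L^p` and `L^q` -/

section LpDuality

variable {α E : Type*} {m : MeasurableSpace α} {μ : Measure α}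
  [NormedAddCommGroup E]

lemma indicatorConstLp_smul [NormedSpace ℝ E] {q : ℝ≥0∞} {s : Set α}
    (hs : MeasurableSet s) (hμs : μ s ≠ ⊤) (a : ℝ) (c : E) :
    indicatorConstLp q hs hμs (a • c) = a • indicatorConstLp q hs hμs c := by
  ext1
  filter_upwards [Lp.coeFn_smul a (indicatorConstLp q hs hμs c),
    indicatorConstLp_coeFn (p := q) (hs := hs) (hμs := hμs) (c := c),
    indicatorConstLp_coeFn (p := q) (hs := hs) (hμs := hμs) (c := a • c)] with x h1 h2 h3
  rw [h3, h1, Pi.smul_apply, h2]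
  by_cases hx : x ∈ s <;> simp [hx]

lemma sum_indicatorConstLp {q : ℝ≥0∞} [IsFiniteMeasure μ] {ι : Type*} (F : Finset ι)
    {f : ι → Set α} (hf : ∀ i, MeasurableSet (f i)) (hd : Pairwise (Function.onFun Disjoint f))
    (c : E) :
    ∑ i ∈ F, indicatorConstLp q (hf i) (measure_ne_top μ _) c
      = indicatorConstLp q (Finset.measurableSet_biUnion F fun i _ => hf i)
          (measure_ne_top μ _) c := by
  classical
  induction F using Finset.induction_on with
  | empty => simp
  | insert a F ha ih =>
    rw [Finset.sum_insert ha, ih, ← indicatorConstLp_disjoint_union]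
    · congr 1
      simp
    · simp only [disjoint_iUnion_right]
      intro i hi
      exact hd (fun h => ha (h ▸ hi))

/-- For finite `q`, convergence in measure of the partial unions is convergence of their indicators
in `L^q`. This is the countable additivity behind `Lp.dualSignedMeasure`. -/
lemma hasSum_indicatorConstLp {q : ℝ≥0∞} [Fact (1 ≤ q)] (hq : q ≠ ⊤) [IsFiniteMeasure μ]
    {f : ℕ → Set α} (hf : ∀ i, MeasurableSet (f i)) (hd : Pairwise (Function.onFun Disjoint f))
    (c : E) :
    HasSum (fun i => indicatorConstLp q (hf i) (measure_ne_top μ _) c)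
      (indicatorConstLp q (MeasurableSet.iUnion hf) (measure_ne_top μ _) c) := by
  rw [HasSum]
  simp_rw [sum_indicatorConstLp _ hf hd c]
  refine tendsto_indicatorConstLp_set hq ?_
  have hsum : ∑' i, μ (f i) ≠ ⊤ := by
    rw [← measure_iUnion hd hf]
    exact measure_ne_top _ _
  -- The symmetric difference lies in the union of the sets left out, whose measure is at most the
  -- tail of a convergent series.
  refine tendsto_of_tendsto_of_tendsto_of_le_of_le tendsto_const_nhds
    (ENNReal.tendsto_tsum_compl_atTop_zero hsum) (fun _ => zero_le) fun F => ?_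
  refine (measure_mono ?_).trans (measure_iUnion_le fun i : { i // i ∉ F } => f i)
  rintro x (⟨hx, hx'⟩ | ⟨hx, hx'⟩)
  · simp only [mem_iUnion] at hx hx'
    obtain ⟨i, -, hi⟩ := hx
    exact absurd ⟨i, hi⟩ hx'
  · simp only [mem_iUnion] at hx hx' ⊢
    obtain ⟨i, hi⟩ := hx
    exact ⟨⟨i, fun h => hx' ⟨i, h, hi⟩⟩, hi⟩

lemma Lp.norm_rpow_eq_integral {r : ℝ} (hr : 0 < r) (V : Lp E (ENNReal.ofReal r) μ) :
    ‖V‖ ^ r = ∫ x, ‖V x‖ ^ r ∂μ := by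
  rw [Lp.norm_def, (Lp.memLp V).eLpNorm_eq_integral_rpow_norm (by simpa using hr) (by simp),
    ENNReal.toReal_ofReal hr.le]
  have h0 : 0 ≤ ∫ x, ‖V x‖ ^ r ∂μ := integral_nonneg fun x => by positivity
  rw [ENNReal.toReal_ofReal (by positivity), ← Real.rpow_mul h0, inv_mul_cancel₀ hr.ne',
    Real.rpow_one]

lemma Lp.integrable_norm_rpow {r : ℝ} (hr : 0 < r) (V : Lp E (ENNReal.ofReal r) μ) :
    Integrable (fun x => ‖V x‖ ^ r) μ := by
  have := (Lp.memLp V).integrable_norm_rpow (by simpa using hr) (by simp)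
  rwa [ENNReal.toReal_ofReal hr.le] at this

variable [InnerProductSpace ℝ E]

open scoped Classical in
/-- The signed measure `A ↦ T (c 1_A)` attached to a functional `T` on `L^q`. -/
def Lp.dualSignedMeasure {q : ℝ≥0∞} [Fact (1 ≤ q)] (hq : q ≠ ⊤) [IsFiniteMeasure μ]
    (T : StrongDual ℝ (Lp E q μ)) (c : E) : SignedMeasure α where
  measureOf' s := if hs : MeasurableSet s then
    T (indicatorConstLp q hs (measure_ne_top μ s) c) else 0
  empty' := by simp
  not_measurable' s hs := by simp [hs]
  m_iUnion' f hf hd := by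
    simp only [hf, MeasurableSet.iUnion hf, dif_pos]
    exact (hasSum_indicatorConstLp hq hf hd c).mapL T

lemma Lp.dualSignedMeasure_apply {q : ℝ≥0∞} [Fact (1 ≤ q)] (hq : q ≠ ⊤) [IsFiniteMeasure μ]
    (T : StrongDual ℝ (Lp E q μ)) (c : E) {s : Set α} (hs : MeasurableSet s) :
    Lp.dualSignedMeasure hq T c s = T (indicatorConstLp q hs (measure_ne_top μ s) c) :=
  dif_pos hs

/-- Radon-Nikodym: a functional on `L^q` has an integrable density. -/
lemma Lp.exists_density [FiniteDimensional ℝ E] {q : ℝ≥0∞} [Fact (1 ≤ q)] (hq : q ≠ ⊤)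
    [IsFiniteMeasure μ] (T : StrongDual ℝ (Lp E q μ)) :
    ∃ g : α → E, Integrable g μ ∧ ∀ (s : Set α) (hs : MeasurableSet s) (c : E),
      T (indicatorConstLp q hs (measure_ne_top μ s) c) = ∫ x in s, inner ℝ (g x) c ∂μ := by
  let b := stdOrthonormalBasis ℝ E
  let ν := fun i => Lp.dualSignedMeasure hq T (b i)
  have hac : ∀ i, ν i ≪ᵥ μ.toENNRealVectorMeasure := by
    intro i
    refine VectorMeasure.AbsolutelyContinuous.mk fun s hs h0 => ?_
    rw [Measure.toENNRealVectorMeasure_apply_measurable hs] at h0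
    have : indicatorConstLp q hs (measure_ne_top μ s) (b i) = 0 := by
      ext1
      filter_upwards [indicatorConstLp_coeFn (p := q) (hs := hs) (hμs := measure_ne_top μ s)
        (c := b i), Lp.coeFn_zero E q μ, measure_eq_zero_iff_ae_notMem.1 h0] with x h1 h2 h3
      rw [h1, h2]
      simp [h3]
    rw [Lp.dualSignedMeasure_apply hq T _ hs, this, map_zero]
  have hint : ∀ i, Integrable ((ν i).rnDeriv μ) μ := fun i =>
    SignedMeasure.integrable_rnDeriv _ _
  have hdens : ∀ i (s : Set α) (hs : MeasurableSet s),
      T (indicatorConstLp q hs (measure_ne_top μ s) (b i)) = ∫ x in s, (ν i).rnDeriv μ x ∂μ := by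
    intro i s hs
    rw [← withDensityᵥ_apply (hint i) hs, SignedMeasure.withDensityᵥ_rnDeriv_eq _ _ (hac i),
      Lp.dualSignedMeasure_apply hq T _ hs]
  refine ⟨fun x => ∑ i, (ν i).rnDeriv μ x • b i,
    integrable_finsetSum _ fun i _ => (hint i).smul_const _, fun s hs c => ?_⟩
  -- For fixed `s` both sides are linear in `c`, so the orthonormal basis vectors suffice.
  let L : E →ₗ[ℝ] ℝ :=
    { toFun := fun c => T (indicatorConstLp q hs (measure_ne_top μ s) c)
      map_add' := fun c c' => by rw [← indicatorConstLp_add, map_add]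
      map_smul' := fun a c => by rw [indicatorConstLp_smul, map_smul]; rfl }
  have hL : L c = ∑ i, inner ℝ (b i) c * L (b i) := by
    conv_lhs => rw [← b.sum_repr' c]
    simp
  change L c = _
  rw [hL]
  simp_rw [sum_inner, real_inner_smul_left]
  rw [integral_finsetSum _ fun i _ => ((hint i).integrableOn).mul_const _]
  refine Finset.sum_congr rfl fun i _ => ?_
  rw [integral_mul_const, mul_comm]
  congr 1
  exact hdens i s hs

section Pairing

variable (μ E) in
/-- The pairing `⟨V, G⟩ = ∫ V · G` of `L^p` and `L^q`. -/
def Lp.innerPairing (p q : ℝ≥0∞) [Fact (1 ≤ p)] [Fact (1 ≤ q)] [ENNReal.HolderConjugate p q] :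
    Lp E p μ →L[ℝ] StrongDual ℝ (Lp E q μ) :=
  (innerSL ℝ : E →L[ℝ] E →L[ℝ] ℝ).lpPairing μ p q

variable {p q : ℝ≥0∞} [Fact (1 ≤ p)] [Fact (1 ≤ q)] [ENNReal.HolderConjugate p q]

lemma Lp.innerPairing_apply (V : Lp E p μ) (G : Lp E q μ) :
    Lp.innerPairing E μ p q V G = ∫ x, inner ℝ (V x) (G x) ∂μ :=
  (innerSL ℝ : E →L[ℝ] E →L[ℝ] ℝ).lpPairing_eq_integral V G

lemma Lp.innerPairing_indicatorConstLp (V : Lp E p μ) {s : Set α} (hs : MeasurableSet s)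
    (hμs : μ s ≠ ⊤) (c : E) :
    Lp.innerPairing E μ p q V (indicatorConstLp q hs hμs c) = ∫ x in s, inner ℝ (V x) c ∂μ := by
  rw [Lp.innerPairing_apply, ← integral_indicator hs]
  refine integral_congr_ae ?_
  filter_upwards [indicatorConstLp_coeFn (p := q) (hs := hs) (hμs := hμs) (c := c)] with x hx
  rw [hx]
  by_cases h : x ∈ s <;> simp [h]

/-- Simple functions are dense in `L^q` for finite `q`. -/
lemma Lp.dual_ext (hq : q ≠ ⊤) {S T : StrongDual ℝ (Lp E q μ)}
    (h : ∀ (s : Set α) (hs : MeasurableSet s) (hμs : μ s ≠ ⊤) (c : E),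
      S (indicatorConstLp q hs hμs c) = T (indicatorConstLp q hs hμs c)) : S = T := by
  ext G
  induction G using Lp.induction hq with
  | indicatorConst c hs hμs => exact h _ hs hμs.ne c
  | add hf hg _ h1 h2 => rw [map_add, map_add, h1, h2]
  | isClosed => exact isClosed_eq S.continuous T.continuous

end Pairing

section Real

variable {p q : ℝ} [Fact (1 ≤ ENNReal.ofReal p)] [Fact (1 ≤ ENNReal.ofReal q)]
  [ENNReal.HolderConjugate (ENNReal.ofReal p) (ENNReal.ofReal q)]

/-- Testing with `‖V‖^{p-2} V`. -/
lemma Lp.norm_le_norm_innerPairing (hpq : p.HolderConjugate q) (V : Lp E (ENNReal.ofReal p) μ) :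
    ‖V‖ ≤ ‖Lp.innerPairing E μ (ENNReal.ofReal p) (ENNReal.ofReal q) V‖ := by
  have hp := hpq.pos
  have hq := hpq.symm.pos
  -- The equality case of Hölder: since `(p - 1) q = p`, both `‖f‖ ^ q` and `V · f` equal `‖V‖ ^ p`.
  -- Where `V` vanishes the scalar factor is harmless even for `p < 2`, as it multiplies the zero
  -- vector.
  set f : α → E := fun x => ‖V x‖ ^ (p - 2) • V x with hf
  have hV := Lp.aestronglyMeasurable V
  have hfm : AEStronglyMeasurable f μ :=
    (hV.norm.aemeasurable.pow_const _).aestronglyMeasurable.smul hV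
  have hnorm : ∀ x, ‖f x‖ ^ q = ‖V x‖ ^ p := by
    intro x
    rcases eq_or_ne (V x) 0 with h | h
    · simp [hf, h, hp.ne', hq.ne']
    · have h' : 0 < ‖V x‖ := norm_pos_iff.2 h
      rw [hf]
      simp only [norm_smul]
      rw [Real.norm_of_nonneg (by positivity), ← Real.rpow_add_one h'.ne', ← Real.rpow_mul h'.le]
      congr 1
      have := hpq.sub_one_mul_conj
      linarith
  have hinner : ∀ x, inner ℝ (V x) (f x) = ‖V x‖ ^ p := by
    intro x
    rcases eq_or_ne (V x) 0 with h | h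
    · simp [hf, h, hp.ne']
    · have h' : 0 < ‖V x‖ := norm_pos_iff.2 h
      rw [hf]
      simp only [real_inner_smul_right]
      rw [real_inner_self_eq_norm_sq, ← Real.rpow_natCast, ← Real.rpow_add h']
      congr 1
      push_cast
      ring
  have hfL : MemLp f (ENNReal.ofReal q) μ := by
    rw [← integrable_norm_rpow_iff hfm (by simpa using hq) (by simp), ENNReal.toReal_ofReal hq.le]
    simp_rw [hnorm]
    exact Lp.integrable_norm_rpow hp V
  set G := hfL.toLp f
  have hG : G =ᵐ[μ] f := hfL.coeFn_toLp
  have h1 : ‖G‖ ^ q = ‖V‖ ^ p := by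
    rw [Lp.norm_rpow_eq_integral hq, Lp.norm_rpow_eq_integral hp]
    refine integral_congr_ae ?_
    filter_upwards [hG] with x hx
    rw [hx, hnorm]
  have h2 : Lp.innerPairing E μ (ENNReal.ofReal p) (ENNReal.ofReal q) V G = ‖V‖ ^ p := by
    rw [Lp.innerPairing_apply, Lp.norm_rpow_eq_integral hp]
    refine integral_congr_ae ?_
    filter_upwards [hG] with x hx
    rw [hx, hinner]
  rcases (norm_nonneg V).eq_or_lt with h0 | h0
  · rw [← h0]
    positivity
  have h3 : ‖G‖ = ‖V‖ ^ (p - 1) := by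
    refine (Real.rpow_left_inj (norm_nonneg G) (by positivity) hq.ne').1 ?_
    rw [h1, ← Real.rpow_mul h0.le, hpq.sub_one_mul_conj]
  have h4 := (le_abs_self _).trans
    ((Lp.innerPairing E μ (ENNReal.ofReal p) (ENNReal.ofReal q) V).le_opNorm G)
  rw [h2, h3, show ‖V‖ ^ p = ‖V‖ * ‖V‖ ^ (p - 1) by
    rw [mul_comm, ← Real.rpow_add_one h0.ne', sub_add_cancel]] at h4
  exact le_of_mul_le_mul_right h4 (by positivity)

/-- Riesz representation of the dual of `L^q`. -/
theorem Lp.exists_innerPairing_eq [FiniteDimensional ℝ E] [IsFiniteMeasure μ]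
    (hpq : p.HolderConjugate q) (T : StrongDual ℝ (Lp E (ENNReal.ofReal q) μ)) :
    ∃ V : Lp E (ENNReal.ofReal p) μ,
      Lp.innerPairing E μ (ENNReal.ofReal p) (ENNReal.ofReal q) V = T ∧ ‖V‖ ≤ ‖T‖ := by
  have hqt : ENNReal.ofReal q ≠ ⊤ := ENNReal.ofReal_ne_top
  obtain ⟨g, hg, hgT⟩ := Lp.exists_density hqt T
  set g' := hg.aestronglyMeasurable.mk g
  have hgm : StronglyMeasurable g' := hg.aestronglyMeasurable.stronglyMeasurable_mk
  have hgg : g =ᵐ[μ] g' := hg.aestronglyMeasurable.ae_eq_mk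
  have hgT' : ∀ (s : Set α) (hs : MeasurableSet s) (c : E),
      T (indicatorConstLp _ hs (measure_ne_top μ s) c) = ∫ x in s, inner ℝ (g' x) c ∂μ := by
    intro s hs c
    rw [hgT s hs c]
    refine integral_congr_ae ?_
    filter_upwards [ae_restrict_of_ae hgg] with x hx
    rw [hx]
  -- The density is only known to be integrable. Its truncations are bounded, hence in `L^p`; their
  -- norms are bounded by `‖T‖` uniformly in `n`, and Fatou's lemma passes this bound to `g'`.
  let A : ℕ → Set α := fun n => {x | ‖g' x‖ ≤ n}
  have hA : ∀ n, MeasurableSet (A n) := fun n =>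
    measurableSet_le hgm.norm.measurable measurable_const
  have hmem : ∀ n, MemLp ((A n).indicator g') (ENNReal.ofReal p) μ := by
    intro n
    refine MemLp.of_bound ((hgm.indicator (hA n)).aestronglyMeasurable) n
      (Filter.Eventually.of_forall fun x => ?_)
    by_cases hx : x ∈ A n
    · rw [indicator_of_mem hx]
      exact hx
    · simp [hx]
  let V : ℕ → Lp E (ENNReal.ofReal p) μ := fun n => (hmem n).toLp _
  have hVn : ∀ n, ‖V n‖ ≤ ‖T‖ := by
    intro n
    let χ : Lp ℝ ⊤ μ := indicatorConstLp ⊤ (hA n) (measure_ne_top μ _) 1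
    -- Multiplication by the indicator of `A n` is a contraction of `L^q`, and pairing with the
    -- truncation `V n` is `T` composed with it.
    let M : Lp E (ENNReal.ofReal q) μ →L[ℝ] Lp E (ENNReal.ofReal q) μ :=
      (ContinuousLinearMap.lsmul ℝ ℝ : ℝ →L[ℝ] E →L[ℝ] E).holderL μ ⊤ (ENNReal.ofReal q)
        (ENNReal.ofReal q) χ
    have hM : ‖M‖ ≤ 1 := by
      refine M.opNorm_le_bound zero_le_one fun G => ?_
      refine (ContinuousLinearMap.norm_holder_apply_apply_le (r := ENNReal.ofReal q)
        (ContinuousLinearMap.lsmul ℝ ℝ : ℝ →L[ℝ] E →L[ℝ] E) χ G).trans ?_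
      have h1 : ‖χ‖ ≤ 1 := by
        refine norm_indicatorConstLp_le.trans ?_
        simp
      have h2 : ‖(ContinuousLinearMap.lsmul ℝ ℝ : ℝ →L[ℝ] E →L[ℝ] E)‖ ≤ 1 :=
        ContinuousLinearMap.opNorm_lsmul_le
      gcongr
      exact mul_le_one₀ h2 (norm_nonneg _) h1
    have hVT : Lp.innerPairing E μ (ENNReal.ofReal p) (ENNReal.ofReal q) (V n) = T.comp M := by
      refine Lp.dual_ext hqt fun s hs hμs c => ?_
      rw [Lp.innerPairing_indicatorConstLp]
      have hMi : M (indicatorConstLp _ hs hμs c)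
          = indicatorConstLp _ (hs.inter (hA n)) (measure_ne_top μ _) c := by
        ext1
        filter_upwards [ContinuousLinearMap.coeFn_holder (r := ENNReal.ofReal q)
          (ContinuousLinearMap.lsmul ℝ ℝ : ℝ →L[ℝ] E →L[ℝ] E) χ
            (indicatorConstLp (ENNReal.ofReal q) hs hμs c),
          indicatorConstLp_coeFn (p := ENNReal.ofReal q) (hs := hs) (hμs := hμs) (c := c),
          indicatorConstLp_coeFn (p := ENNReal.ofReal q) (hs := hs.inter (hA n))
            (hμs := measure_ne_top μ _) (c := c),
          indicatorConstLp_coeFn (p := ⊤) (hs := hA n) (hμs := measure_ne_top μ _)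
            (c := (1 : ℝ))] with x h1 h2 h3 h4
        refine h1.trans ?_
        rw [h2, h3, h4]
        by_cases hx : x ∈ s <;> by_cases hx' : x ∈ A n <;> simp [hx, hx']
      rw [ContinuousLinearMap.comp_apply, hMi, hgT', ← setIntegral_indicator (hA n)]
      refine integral_congr_ae ?_
      filter_upwards [ae_restrict_of_ae (hmem n).coeFn_toLp] with x hx
      rw [hx]
      by_cases hx' : x ∈ A n <;> simp [hx']
    calc ‖V n‖ ≤ ‖T.comp M‖ := hVT ▸ Lp.norm_le_norm_innerPairing hpq (V n)
      _ ≤ ‖T‖ * ‖M‖ := ContinuousLinearMap.opNorm_comp_le _ _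
      _ ≤ ‖T‖ * 1 := by gcongr
      _ = ‖T‖ := mul_one _
  have hle : eLpNorm g' (ENNReal.ofReal p) μ ≤ ENNReal.ofReal ‖T‖ := by
    refine (Lp.eLpNorm_lim_le_liminf_eLpNorm (f := fun n => (A n).indicator g')
      (fun n => (hmem n).1) g' (Filter.Eventually.of_forall fun x => ?_)).trans ?_
    · refine tendsto_const_nhds.congr' ?_
      obtain ⟨n, hn⟩ := exists_nat_ge ‖g' x‖
      filter_upwards [Filter.eventually_ge_atTop n] with k hk
      rw [indicator_of_mem]
      exact hn.trans (by exact_mod_cast hk)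
    · refine Filter.liminf_le_of_le (by isBoundedDefault) fun b hb => ?_
      obtain ⟨n, hn⟩ := hb.exists
      refine hn.trans ?_
      rw [← ENNReal.ofReal_toReal (hmem n).eLpNorm_ne_top, ← Lp.norm_toLp _ (hmem n)]
      exact ENNReal.ofReal_le_ofReal (hVn n)
  have hgL : MemLp g' (ENNReal.ofReal p) μ :=
    ⟨hgm.aestronglyMeasurable, hle.trans_lt ENNReal.ofReal_lt_top⟩
  refine ⟨hgL.toLp g', ?_, ?_⟩
  · refine Lp.dual_ext hqt fun s hs hμs c => ?_
    rw [Lp.innerPairing_indicatorConstLp, hgT']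
    refine integral_congr_ae ?_
    filter_upwards [ae_restrict_of_ae hgL.coeFn_toLp] with x hx
    rw [hx]
  · rw [Lp.norm_toLp]
    exact ENNReal.toReal_le_of_le_ofReal (norm_nonneg T) hle

end Real

end LpDuality

end MeasureTheory

end

/-! ### Convex analysis: continuity, the direct method, affine minorants -/

noncomputable section

/-- A convex function that is bounded above on a ball is continuous. -/
lemma ConvexOn.continuous_of_bddAbove_ball {X : Type*} [SeminormedAddCommGroup X]
    [NormedSpace ℝ X] [T0Space X] {F : X → ℝ} (hF : ConvexOn ℝ univ F) {x₀ : X} {r C : ℝ} (hr : 0 < r)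
    (hC : ∀ x ∈ Metric.ball x₀ r, F x ≤ C) : Continuous F := by
  let : NormedAddCommGroup X := NormedAddCommGroup.ofSeparation fun x hx =>
    (inseparable_zero_iff_norm.2 hx).eq
  rw [← continuousOn_univ]
  have h := (hF.continuousOn_tfae isOpen_univ ⟨x₀, mem_univ x₀⟩).out 1 3
  refine h.2 ⟨x₀, mem_univ _, C, ?_⟩
  rw [Filter.eventually_map]
  filter_upwards [Metric.ball_mem_nhds x₀ hr] with x hx using hC x hx

/-- The direct method in a reflexive space. Reflexivity is expressed through a pairing of `X` and
`Y` that represents all functionals on `Y` and all functionals on `X`. -/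
lemma ConvexOn.exists_isMinOn_of_pairing {X Y : Type*} [NormedAddCommGroup X] [NormedSpace ℝ X]
    [NormedAddCommGroup Y] [NormedSpace ℝ Y] (Φ : X →L[ℝ] StrongDual ℝ Y)
    (hsurj : Function.Surjective Φ)
    (hflip : ∀ f : StrongDual ℝ X, ∃ y, ∀ x, f x = Φ x y) {A : Set X} (hA : IsClosed A)
    (hne : A.Nonempty) {F : X → ℝ} (hF : ConvexOn ℝ A F) (hcont : Continuous F)
    (hbdd : ∀ c, Bornology.IsBounded {x ∈ A | F x ≤ c}) : ∃ x ∈ A, ∀ y ∈ A, F x ≤ F y := by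
  let K : A → Set X := fun a => {x ∈ A | F x ≤ F a}
  -- The intersection of the weak-star closed half-spaces containing `Φ (K a)`, hence weak-star
  -- closed. Hahn–Banach in `X`, with functionals represented by `Y`, shows that it adds no points
  -- to `Φ (K a)`; boundedness of `K a` and Banach–Alaoglu then make it compact.
  let C : A → Set (WeakDual ℝ Y) := fun a => {T | ∀ y c, (∀ x ∈ K a, Φ x y ≤ c) → T y ≤ c}
  have hCK : ∀ a x, StrongDual.toWeakDual (Φ x) ∈ C a → x ∈ K a := by
    intro a x hx
    by_contra hxK
    obtain ⟨f, u, h1, h2⟩ := geometric_hahn_banach_closed_point (hF.convex_le (F a))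
      (hA.inter (isClosed_le hcont continuous_const)) hxK
    obtain ⟨y, hy⟩ := hflip f
    have := hx y u fun z hz => by
      rw [← hy]
      exact (h1 z hz).le
    rw [StrongDual.toWeakDual_apply, ← hy] at this
    exact absurd this h2.not_ge
  have hclosed : ∀ a, IsClosed (C a) := by
    intro a
    simp only [C, Set.ofPred_forall]
    refine isClosed_iInter fun y => isClosed_iInter fun c => isClosed_iInter fun _ => ?_
    exact isClosed_le (WeakDual.eval_continuous y) continuous_const
  have hcompact : ∀ a, IsCompact (C a) := by
    intro a
    obtain ⟨R, hR⟩ := (hbdd (F a)).exists_norm_le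
    refine (WeakDual.isCompact_closedBall (𝕜 := ℝ) (E := Y) 0 (‖Φ‖ * R)).of_isClosed_subset
      (hclosed a) fun T hT => ?_
    obtain ⟨x, hx⟩ := hsurj (WeakDual.toStrongDual T)
    have hTx : T = StrongDual.toWeakDual (Φ x) := by rw [hx]; rfl
    have hxK := hCK a x (hTx ▸ hT)
    rw [mem_preimage, mem_closedBall_zero_iff, ← hx]
    exact (Φ.le_opNorm x).trans (by gcongr; exact hR x hxK)
  have : Nonempty A := hne.to_subtype
  -- Sublevel sets are totally ordered by inclusion; a point common to all of them is a minimizer.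
  obtain ⟨T, hT⟩ := IsCompact.nonempty_iInter_of_directed_nonempty_isCompact_isClosed C
    (by
      intro a b
      rcases le_total (F a) (F b) with h | h
      · exact ⟨a, subset_rfl, fun T hT y c hc => hT y c fun x hx => hc x ⟨hx.1, hx.2.trans h⟩⟩
      · exact ⟨b, fun T hT y c hc => hT y c fun x hx => hc x ⟨hx.1, hx.2.trans h⟩, subset_rfl⟩)
    (fun a => ⟨StrongDual.toWeakDual (Φ a), fun y c hc => hc a ⟨a.2, le_rfl⟩⟩)
    hcompact hclosed
  obtain ⟨x, hx⟩ := hsurj (WeakDual.toStrongDual T)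
  have hTx : T = StrongDual.toWeakDual (Φ x) := by rw [hx]; rfl
  have hxK : ∀ a, x ∈ K a := fun a => hCK a x (hTx ▸ mem_iInter.1 hT a)
  exact ⟨x, (hxK this.some).1, fun y hy => (hxK ⟨y, hy⟩).2⟩

/-- A continuous convex function is the pointwise supremum of its continuous affine minorants. -/
lemma ConvexOn.isLUB_continuousAffine {X : Type*} [SeminormedAddCommGroup X] [NormedSpace ℝ X]
    {F : X → ℝ} (hF : ConvexOn ℝ univ F) (hcont : Continuous F) (x : X) :
    IsLUB ((fun L : X →ᴬ[ℝ] ℝ => L x) '' {L | ∀ y, L y ≤ F y}) (F x) := by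
  refine ⟨by rintro _ ⟨L, hL, rfl⟩; exact hL x, fun c hc => ?_⟩
  by_contra! hlt
  -- The point `(x, a')` lies strictly below the epigraph, so separation yields an affine minorant
  -- with value `a'` at `x`, exceeding `c`.
  obtain ⟨a', hca, haF⟩ := exists_between hlt
  obtain ⟨l, a, h1, h2⟩ := ConvexOn.exists_affine_le_of_lt (𝕜 := ℝ) (mem_univ x) haF isClosed_univ
    (lowerSemicontinuousOn_univ_iff.2 hcont.lowerSemicontinuous) hF
  let L : X →ᴬ[ℝ] ℝ := l.toContinuousAffineMap + ContinuousAffineMap.const ℝ X a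
  have hL : ∀ y, L y = l y + a := fun y => rfl
  have hLx : L x = a' := by rw [hL]; simpa using h2
  refine (hc ⟨L, fun y => ?_, hLx⟩).not_gt hca
  rw [hL]
  simpa using h1 ⟨y, mem_univ y⟩

/-- A supremum of continuous affine functionals is weakly lower semicontinuous. -/
lemma lowerSemicontinuous_weakSpace_of_isLUB {X : Type*} [SeminormedAddCommGroup X] [NormedSpace ℝ X]
    {F : X → ℝ} {S : Set (X →ᴬ[ℝ] ℝ)} (hS : ∀ x, IsLUB ((fun L => L x) '' S) (F x)) :
    LowerSemicontinuous (fun x : WeakSpace ℝ X => F ((toWeakSpace ℝ X).symm x)) := by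
  intro x c hc
  obtain ⟨_, ⟨L, hL, rfl⟩, hcL⟩ := (lt_isLUB_iff (hS _)).1 hc
  have hcont : Continuous fun y : WeakSpace ℝ X => L ((toWeakSpace ℝ X).symm y) := by
    have h1 : (fun y : WeakSpace ℝ X => L ((toWeakSpace ℝ X).symm y))
        = fun y => L.contLinear ((toWeakSpace ℝ X).symm y) + L 0 :=
      funext fun y => congrFun L.decomp _
    rw [h1]
    exact (WeakBilin.eval_continuous _ L.contLinear).add continuous_const
  filter_upwards [hcont.continuousAt.eventually (lt_mem_nhds hcL)] with y hy
  exact hy.trans_le ((hS _).1 ⟨L, hL, rfl⟩)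

end

noncomputable section

namespace Beckmann

variable {N : ℕ} {Ω : SmoothDomain N}

/-! ### The energy on `L^p`: integrability, convexity, continuity, coercivity -/

section Energy

variable {p : ℝ} {H : EuclideanSpace ℝ (Fin N) → EuclideanSpace ℝ (Fin N) → ℝ}

lemma SmoothDomain.ae_mem_closedSet (Ω : SmoothDomain N) : ∀ᵐ x ∂Ω.vol, x ∈ Ω.closedSet :=
  (ae_restrict_mem Ω.isOpen.measurableSet).mono fun _ hx => subset_closure hx

/-- Superposition with a Carathéodory function preserves measurability. -/
lemma IsAdmissibleIntegrand.aemeasurable_comp (hH : IsAdmissibleIntegrand Ω p H)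
    {f : EuclideanSpace ℝ (Fin N) → EuclideanSpace ℝ (Fin N)}
    (hf : AEStronglyMeasurable f Ω.vol) : AEMeasurable (fun x => H x (f x)) Ω.vol := by
  have hz : ∀ z, AEMeasurable (fun x => H x z) Ω.vol := fun z =>
    (hH.measurable z).mono_measure (Measure.restrict_mono subset_closure le_rfl)
  -- For a simple function, `z` is frozen on each of finitely many measurable level sets; continuity
  -- in `z` handles the limit.
  have hs : ∀ s : SimpleFunc (EuclideanSpace ℝ (Fin N)) (EuclideanSpace ℝ (Fin N)),
      AEMeasurable (fun x => H x (s x)) Ω.vol := by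
    intro s
    have he : (fun x => H x (s x)) =
        fun x => ∑ z ∈ s.range, (s ⁻¹' {z}).indicator (fun x => H x z) x := by
      ext x
      rw [Finset.sum_eq_single (s x)]
      · simp
      · intro z _ hzx
        exact indicator_of_notMem (fun h => hzx (Eq.symm h)) _
      · intro h
        exact absurd (s.mem_range_self x) h
    rw [he]
    exact Finset.aemeasurable_fun_sum _ fun z _ => (hz z).indicator (s.measurableSet_fiber z)
  have hg := hf.stronglyMeasurable_mk
  refine aemeasurable_of_tendsto_metrizable_ae' (fun n => hs (hg.approx n)) ?_
  filter_upwards [hf.ae_eq_mk, Ω.ae_mem_closedSet] with x hx hxΩ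
  rw [hx]
  exact ((hH.continuous x hxΩ).tendsto _).comp (hg.tendsto_approx x)

lemma IsAdmissibleIntegrand.integrable (hp : 0 < p) (hH : IsAdmissibleIntegrand Ω p H)
    (V : LpVector Ω p) : Integrable (fun x => H x (V x)) Ω.vol := by
  obtain ⟨l, hl, hl1, hg⟩ := hH.growth
  refine Integrable.mono' (g := fun x => (1 / l) * (‖V x‖ ^ p + 1))
    (((Lp.integrable_norm_rpow hp V).add (integrable_const 1)).const_mul _)
    (hH.aemeasurable_comp (Lp.aestronglyMeasurable V)).aestronglyMeasurable ?_
  filter_upwards [Ω.ae_mem_closedSet] with x hx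
  obtain ⟨h1, h2⟩ := hg x hx (V x)
  refine abs_le.2 ⟨?_, h2⟩
  have h3 : 0 ≤ ‖V x‖ ^ p := by positivity
  -- The lower growth bound is at least `-l`, and `l ≤ 1` puts it above `-1 / l`, so one majorant
  -- controls both signs.
  have h4 : l ≤ 1 / l := hl1.trans (one_le_one_div hl hl1)
  nlinarith

/-- The energy is comparable with `‖V‖^p`. -/
lemma IsAdmissibleIntegrand.energy_bounds (hp : 0 < p) (hH : IsAdmissibleIntegrand Ω p H) :
    ∃ l : ℝ, 0 < l ∧ ∀ V : LpVector Ω p, l * (‖V‖ ^ p - Ω.vol.real univ) ≤ energy Ω p H V ∧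
      energy Ω p H V ≤ (1 / l) * (‖V‖ ^ p + Ω.vol.real univ) := by
  obtain ⟨l, hl, -, hg⟩ := hH.growth
  refine ⟨l, hl, fun V => ?_⟩
  have hV := Lp.integrable_norm_rpow hp V
  have e1 : l * (‖V‖ ^ p - Ω.vol.real univ) = ∫ x, l * (‖V x‖ ^ p - 1) ∂Ω.vol := by
    rw [integral_const_mul, integral_sub hV (integrable_const 1), Lp.norm_rpow_eq_integral hp]
    simp
  have e2 : (1 / l) * (‖V‖ ^ p + Ω.vol.real univ) = ∫ x, (1 / l) * (‖V x‖ ^ p + 1) ∂Ω.vol := by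
    rw [integral_const_mul, integral_add hV (integrable_const 1), Lp.norm_rpow_eq_integral hp]
    simp
  rw [e1, e2]
  constructor
  · refine integral_mono_ae ((hV.sub (integrable_const 1)).const_mul _) (hH.integrable hp V) ?_
    filter_upwards [Ω.ae_mem_closedSet] with x hx using (hg x hx _).1
  · refine integral_mono_ae (hH.integrable hp V) ((hV.add (integrable_const 1)).const_mul _) ?_
    filter_upwards [Ω.ae_mem_closedSet] with x hx using (hg x hx _).2

lemma IsAdmissibleIntegrand.convexOn_energy (hp : 0 < p) (hH : IsAdmissibleIntegrand Ω p H) :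
    ConvexOn ℝ univ (energy Ω p H) := by
  refine ⟨convex_univ, fun V _ W _ a b ha hb hab => ?_⟩
  have hV := hH.integrable hp V
  have hW := hH.integrable hp W
  have e : a • energy Ω p H V + b • energy Ω p H W
      = ∫ x, (a * H x (V x) + b * H x (W x)) ∂Ω.vol := by
    rw [integral_add (hV.const_mul a) (hW.const_mul b), integral_const_mul, integral_const_mul]
    rfl
  rw [e]
  refine integral_mono_ae (hH.integrable hp _) ((hV.const_mul a).add (hW.const_mul b)) ?_
  filter_upwards [Ω.ae_mem_closedSet, Lp.coeFn_add (a • V) (b • W), Lp.coeFn_smul a V,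
    Lp.coeFn_smul b W] with x hx h1 h2 h3
  rw [h1, Pi.add_apply, h2, h3]
  exact (hH.convex x hx).2 (mem_univ _) (mem_univ _) ha hb hab

/-- Convexity replaces dominated convergence: the upper growth bounds the energy above on the unit
ball. -/
lemma IsAdmissibleIntegrand.continuous_energy [Fact (1 < p)] (hH : IsAdmissibleIntegrand Ω p H) :
    Continuous (energy Ω p H) := by
  have hp : 0 < p := zero_lt_one.trans Fact.out
  obtain ⟨l, hl, hb⟩ := hH.energy_bounds hp
  refine (hH.convexOn_energy hp).continuous_of_bddAbove_ball (x₀ := 0) (r := 1)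
    (C := (1 / l) * (1 ^ p + Ω.vol.real univ)) one_pos fun V hV => (hb V).2.trans ?_
  gcongr
  exact (mem_ball_zero_iff.1 hV).le

lemma IsAdmissibleIntegrand.isBounded_sublevel [Fact (1 < p)] (hH : IsAdmissibleIntegrand Ω p H)
    (c : ℝ) : Bornology.IsBounded {V | energy Ω p H V ≤ c} := by
  have hp : 0 < p := zero_lt_one.trans Fact.out
  obtain ⟨l, hl, hb⟩ := hH.energy_bounds hp
  -- The absolute value only keeps the base of the power nonnegative; if the sum is negative, the
  -- sublevel set is empty.
  refine isBounded_iff_forall_norm_le.2 ⟨(|c / l + Ω.vol.real univ|) ^ p⁻¹, fun V hV => ?_⟩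
  rw [Real.le_rpow_inv_iff_of_pos (norm_nonneg _) (abs_nonneg _) hp]
  refine le_trans ?_ (le_abs_self _)
  have h1 := (hb V).1.trans hV
  rw [mul_comm, ← le_div_iff₀ hl] at h1
  linarith

end Energy

lemma SmoothDomain.memLp_gradient (Ω : SmoothDomain N) (r : ℝ≥0∞) {φ : EuclideanSpace ℝ (Fin N) → ℝ}
    (hφ : ContDiff ℝ 1 φ) : MemLp (gradient φ) (r) Ω.vol := by
  have hg : Continuous (gradient φ) :=
    (LinearIsometryEquiv.continuous _).comp (hφ.continuous_fderiv (by simp))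
  obtain ⟨C, hC⟩ := Ω.isBounded.isCompact_closure.exists_bound_of_continuousOn hg.continuousOn
  exact MemLp.of_bound hg.aestronglyMeasurable C (Ω.ae_mem_closedSet.mono hC)

/-! ### Competitors and the value functional -/

section Admissible

variable {p q : ℝ} [Fact (1 < p)] [Fact (1 < q)]
  [ENNReal.HolderConjugate (ENNReal.ofReal p) (ENNReal.ofReal q)]

lemma integral_gradient_eq_innerPairing (V : LpVector Ω p)
    (φ : EuclideanSpace ℝ (Fin N) → ℝ) (hφ : ContDiff ℝ 1 φ) :
    ∫ x, inner ℝ (gradient φ x) (V x) ∂Ω.vol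
      = Lp.innerPairing (EuclideanSpace ℝ (Fin N)) Ω.vol (ENNReal.ofReal p) (ENNReal.ofReal q) V
          (HomSobolev.grad Ω q (HomSobolev.mk Ω q (ofC1 Ω q φ hφ))) := by
  have h : HomSobolev.grad Ω q (HomSobolev.mk Ω q (ofC1 Ω q φ hφ)) =ᵐ[Ω.vol] gradient φ :=
    MemLp.coeFn_toLp (Ω.memLp_gradient _ hφ)
  rw [Lp.innerPairing_apply]
  refine integral_congr_ae ?_
  filter_upwards [h] with x hx
  rw [hx, real_inner_comm]

/-- In terms of the pairing, the constraint is visibly linear in `(T, V)` and closed in `V`. -/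
lemma isAdmissible_iff {T : DualSobolev Ω q} {V : LpVector Ω p} :
    IsAdmissible Ω p q T V ↔ ∀ (φ : EuclideanSpace ℝ (Fin N) → ℝ) (hφ : ContDiff ℝ 1 φ),
      Lp.innerPairing (EuclideanSpace ℝ (Fin N)) Ω.vol (ENNReal.ofReal p) (ENNReal.ofReal q) V
          (HomSobolev.grad Ω q (HomSobolev.mk Ω q (ofC1 Ω q φ hφ)))
        = T (HomSobolev.mk Ω q (ofC1 Ω q φ hφ)) :=
  forall₂_congr fun φ hφ => by rw [integral_gradient_eq_innerPairing (q := q) V φ hφ]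

/-- Used with equal data for the convexity of the set of competitors, and with different data for
the convexity of the value functional. -/
lemma IsAdmissible.combo {T T' : DualSobolev Ω q} {V V' : LpVector Ω p}
    (h : IsAdmissible Ω p q T V) (h' : IsAdmissible Ω p q T' V') (a b : ℝ) :
    IsAdmissible Ω p q (a • T + b • T') (a • V + b • V') := by
  rw [isAdmissible_iff] at h h' ⊢
  intro φ hφ
  simp [h φ hφ, h' φ hφ]

lemma convex_setOf_isAdmissible (T : DualSobolev Ω q) :
    Convex ℝ {V : LpVector Ω p | IsAdmissible Ω p q T V} := by
  intro V hV W hW a b _ _ hab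
  have h := IsAdmissible.combo hV hW a b
  rwa [← add_smul, hab, one_smul] at h

lemma isClosed_setOf_isAdmissible (T : DualSobolev Ω q) :
    IsClosed {V : LpVector Ω p | IsAdmissible Ω p q T V} := by
  simp only [isAdmissible_iff, Set.ofPred_forall]
  refine isClosed_iInter fun φ => isClosed_iInter fun hφ => isClosed_eq ?_ continuous_const
  fun_prop

/-- Since the gradient preserves norms, `T` induces a functional on the space of gradients with norm
at most `‖T‖`, to which Hahn–Banach applies. -/
lemma HomSobolev.exists_dual_extension (T : DualSobolev Ω q) :
    ∃ S : StrongDual ℝ (LpVector Ω q), (∀ u, S (HomSobolev.grad Ω q u) = T u) ∧ ‖S‖ ≤ ‖T‖ := by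
  have hnorm : ∀ u : HomSobolev Ω q, ‖u‖ = ‖HomSobolev.grad Ω q u‖ := fun _ => rfl
  obtain ⟨g, hg⟩ := LinearMap.exists_rightInverse_of_surjective
    (HomSobolev.grad Ω q).rangeRestrict (LinearMap.range_rangeRestrict _)
  have hg' : ∀ y, HomSobolev.grad Ω q (g y) = y := fun y =>
    congrArg Subtype.val (LinearMap.congr_fun hg y)
  let f : StrongDual ℝ (LinearMap.range (HomSobolev.grad Ω q)) :=
    (T.toLinearMap.comp g).mkContinuous ‖T‖ fun y => by
      refine (T.le_opNorm (g y)).trans_eq ?_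
      rw [hnorm, hg']
      rfl
  obtain ⟨S, hS, hSn⟩ := exists_extension_norm_eq _ f
  refine ⟨S, fun u => ?_, ?_⟩
  · let y : LinearMap.range (HomSobolev.grad Ω q) := ⟨HomSobolev.grad Ω q u, u, rfl⟩
    have h1 : S (HomSobolev.grad Ω q u) = T (g y) := hS y
    -- The right inverse `g` recovers `u` only up to an element of seminorm zero, on which `T`
    -- vanishes.
    have h2 : ‖g y - u‖ = 0 := by
      rw [hnorm, map_sub, hg', sub_self, norm_zero]
    have h3 : T (g y - u) = 0 := by
      have := T.le_opNorm (g y - u)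
      rw [h2, mul_zero] at this
      exact norm_le_zero_iff.1 this
    rw [h1, ← sub_eq_zero, ← map_sub, h3]
  · rw [hSn]
    exact LinearMap.mkContinuous_norm_le _ (norm_nonneg _) _

lemma exists_isAdmissible (hpq : p.HolderConjugate q) (T : DualSobolev Ω q) :
    ∃ V : LpVector Ω p, IsAdmissible Ω p q T V ∧ ‖V‖ ≤ ‖T‖ := by
  obtain ⟨S, hS, hSn⟩ := HomSobolev.exists_dual_extension T
  obtain ⟨V, hV, hVn⟩ := Lp.exists_innerPairing_eq hpq S
  exact ⟨V, isAdmissible_iff.2 fun φ hφ => by rw [hV, hS], hVn.trans hSn⟩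

variable {H : EuclideanSpace ℝ (Fin N) → EuclideanSpace ℝ (Fin N) → ℝ}

lemma IsAdmissibleIntegrand.isLeast_beckmannValue (hpq : p.HolderConjugate q)
    (hH : IsAdmissibleIntegrand Ω p H) (T : DualSobolev Ω q) :
    IsLeast (competitorEnergies Ω p q H T) (beckmannValue Ω p q H T) := by
  -- Riesz representation is needed in both directions; together they express the reflexivity of
  -- `L^p`.
  have : ENNReal.HolderConjugate (ENNReal.ofReal q) (ENNReal.ofReal p) :=
    hpq.symm.ennrealOfReal
  obtain ⟨V₀, hV₀, -⟩ := exists_isAdmissible (Ω := Ω) hpq T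
  obtain ⟨V, hV, hmin⟩ := ConvexOn.exists_isMinOn_of_pairing
    (Lp.innerPairing (EuclideanSpace ℝ (Fin N)) Ω.vol (ENNReal.ofReal p) (ENNReal.ofReal q))
    (fun S => (Lp.exists_innerPairing_eq hpq S).imp fun _ h => h.1)
    (fun f => by
      obtain ⟨G, hG, -⟩ := Lp.exists_innerPairing_eq hpq.symm f
      refine ⟨G, fun V => ?_⟩
      rw [← hG, Lp.innerPairing_apply, Lp.innerPairing_apply]
      exact integral_congr_ae (Filter.Eventually.of_forall fun x => real_inner_comm _ _))
    (isClosed_setOf_isAdmissible T) ⟨V₀, hV₀⟩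
    ((hH.convexOn_energy hpq.pos).subset (subset_univ _) (convex_setOf_isAdmissible T))
    hH.continuous_energy fun c => (hH.isBounded_sublevel c).subset fun _ h => h.2
  have h : IsLeast (competitorEnergies Ω p q H T) (energy Ω p H V) :=
    ⟨mem_image_of_mem _ hV, by rintro _ ⟨W, hW, rfl⟩; exact hmin W hW⟩
  rw [beckmannValue, h.csInf_eq]
  exact h

/-- A convex combination of minimizers competes for the combined datum. -/
lemma IsAdmissibleIntegrand.convexOn_beckmannValue (hpq : p.HolderConjugate q)
    (hH : IsAdmissibleIntegrand Ω p H) : ConvexOn ℝ univ (beckmannValue Ω p q H) := by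
  refine ⟨convex_univ, fun T _ T' _ a b ha hb hab => ?_⟩
  obtain ⟨V, hV, hVT⟩ := (hH.isLeast_beckmannValue hpq T).1
  obtain ⟨V', hV', hVT'⟩ := (hH.isLeast_beckmannValue hpq T').1
  rw [← hVT, ← hVT']
  exact ((hH.isLeast_beckmannValue hpq _).2 (mem_image_of_mem _ (hV.combo hV' a b))).trans
    ((hH.convexOn_energy hpq.pos).2 (mem_univ _) (mem_univ _) ha hb hab)

/-- The competitor with `‖V‖ ≤ ‖T‖` bounds the value above on the unit ball, which suffices by
convexity. -/
lemma IsAdmissibleIntegrand.continuous_beckmannValue (hpq : p.HolderConjugate q)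
    (hH : IsAdmissibleIntegrand Ω p H) : Continuous (beckmannValue Ω p q H) := by
  have hp := hpq.pos
  obtain ⟨l, hl, hb⟩ := hH.energy_bounds hp
  refine (hH.convexOn_beckmannValue hpq).continuous_of_bddAbove_ball (x₀ := (0 : DualSobolev Ω q)) (r := 1)
    (C := (1 / l) * (1 ^ p + Ω.vol.real univ)) one_pos fun T hT => ?_
  obtain ⟨V, hV, hVT⟩ := exists_isAdmissible (Ω := Ω) hpq T
  refine ((hH.isLeast_beckmannValue hpq T).2 (mem_image_of_mem _ hV)).trans ((hb V).2.trans ?_)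
  gcongr
  exact hVT.trans (mem_ball_zero_iff.1 hT).le

end Admissible

end Beckmann

end

theorem corollary3p3 {N : ℕ} (Ω : Beckmann.SmoothDomain N) (p q : ℝ) [Fact (1 < q)]
    (hp : 1 < p) (hq : q = p / (p - 1))
    (H : EuclideanSpace ℝ (Fin N) → EuclideanSpace ℝ (Fin N) → ℝ)
    (hH : Beckmann.IsAdmissibleIntegrand Ω p H) :
    -- the minimum in Beckmann's problem exists for every datum
    (∀ T : Beckmann.DualSobolev Ω q,
      IsLeast (Beckmann.competitorEnergies Ω p q H T) (Beckmann.beckmannValue Ω p q H T)) ∧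
    -- the value functional is convex
    ConvexOn ℝ Set.univ (Beckmann.beckmannValue Ω p q H) ∧
    -- it is lower semicontinuous for the weak topology of the dual Sobolev space
    LowerSemicontinuous (fun T : WeakSpace ℝ (Beckmann.DualSobolev Ω q) =>
      Beckmann.beckmannValue Ω p q H ((toWeakSpace ℝ (Beckmann.DualSobolev Ω q)).symm T)) ∧
    -- it is the pointwise supremum of a family of continuous affine functionals
    (∃ S : Set (Beckmann.DualSobolev Ω q →ᴬ[ℝ] ℝ), ∀ T : Beckmann.DualSobolev Ω q,
      IsLUB ((fun L => L T) '' S) (Beckmann.beckmannValue Ω p q H T)) := by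
  have hpq : p.HolderConjugate q := by
    rw [hq]
    exact Real.HolderConjugate.conjExponent hp
  have : Fact (1 < p) := ⟨hp⟩
  have : ENNReal.HolderConjugate (ENNReal.ofReal p) (ENNReal.ofReal q) := hpq.ennrealOfReal
  have hconv := hH.convexOn_beckmannValue hpq
  have hsup := hconv.isLUB_continuousAffine (hH.continuous_beckmannValue hpq)
  exact ⟨hH.isLeast_beckmannValue hpq, hconv, lowerSemicontinuous_weakSpace_of_isLUB hsup,
    _, hsup⟩
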